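/- Let $W$ be a real vector space of dimension $5$, with its standard topology, endowed with a symmetric bilinear form $\cdot$ of signature $(3,2)$, and give the projective space $\mathbb{P}(W)$ the quotient topology. An Einstein torus is a subset of $\mathbb{P}(W)$ of the form $$T_s=\{[v]\in\mathbb{P}(W) : v\neq 0,\ v\cdot v=0,\ v\cdot s=0\}$$ for a vector $s\in W$ with $s\cdot s>0$ (it is a $2$-torus in the Einstein universe $\mathrm{Ein}^3=\{[v] : v\ne 0,\ v\cdot v=0\}$). Let $T_1\neq T_2$ be two Einstein tori. Then $T_1\cap T_2$ is non-contractible in each of the two tori: for $i=1,2$ the inclusion $T_1\cap T_2\hookrightarrow T_i$ is not homotopic to a constant map (in particular, $T_1\cap T_2$ is non-empty), and some loop contained in $T_1\cap T_2$ represents a nontrivial element of $\pi_1(T_i)$. -/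

import Mathlib

open scoped LinearAlgebra.Projectivization

namespace EinsteinGeometry

/-- The quotient topology on a projective space (from the nonzero vectors). -/
instance projectivizationTopology {W : Type*} [AddCommGroup W] [Module ℝ W]
    [TopologicalSpace W] : TopologicalSpace (ℙ ℝ W) :=
  inferInstanceAs (TopologicalSpace (Quotient (projectivizationSetoid ℝ W)))

section Algebra

variable {W : Type*} [AddCommGroup W] [Module ℝ W]

/-- `B` is a symmetric bilinear form of signature `(p, q)` on a real vector space of
dimension `p + q`; in particular it is nondegenerate. -/
structure HasSignature (B : LinearMap.BilinForm ℝ W) (p q : ℕ) : Prop where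
  symm : B.IsSymm
  finrank_eq : Module.finrank ℝ W = p + q
  sigPos_eq : sigPos B.toQuadraticMap = p
  sigNeg_eq : sigNeg B.toQuadraticMap = q

/-- The null cone of a bilinear form. -/
def nullCone (B : LinearMap.BilinForm ℝ W) : Set W := {v | B v v = 0}

/-- The projectivization of a set `A` of vectors: the points `[v]` with `0 ≠ v ∈ A`. -/
def projectivize (A : Set W) : Set (ℙ ℝ W) :=
  {p | ∃ (v : W) (hv : v ≠ 0), v ∈ A ∧ p = Projectivization.mk ℝ v hv}

/-- The Einstein universe of a bilinear form (of signature `(n, 2)`). -/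
def einsteinUniverse (B : LinearMap.BilinForm ℝ W) : Set (ℙ ℝ W) :=
  projectivize (nullCone B)

/-- The vectors orthogonal to `s`. -/
def perp (B : LinearMap.BilinForm ℝ W) (s : W) : Set W := {v | B s v = 0}

/-- An Einstein hyperplane: the projectivized null cone of the hyperplane orthogonal to a
spacelike vector `s`. In signature `(3, 2)` these are the Einstein tori. -/
def IsEinsteinHyperplane (B : LinearMap.BilinForm ℝ W) (H : Set (ℙ ℝ W)) : Prop :=
  ∃ s : W, 0 < B s s ∧ H = projectivize (nullCone B ∩ perp B s)

theorem IsEinsteinHyperplane.subset_einsteinUniverse {B : LinearMap.BilinForm ℝ W}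
    {H : Set (ℙ ℝ W)} (h : IsEinsteinHyperplane B H) : H ⊆ einsteinUniverse B := by
  obtain ⟨s, -, rfl⟩ := h
  rintro p ⟨v, hv, hA, rfl⟩
  exact ⟨v, hv, hA.1, rfl⟩

end Algebra

section Topology

variable {X : Type*} [TopologicalSpace X]

/-- `A ⊆ Y` is contractible in `Y`: the inclusion `A → Y` is homotopic to a constant map. -/
def ContractibleIn {A Y : Set X} (h : A ⊆ Y) : Prop :=
  (ContinuousMap.inclusion h).Nullhomotopic

/-- Some loop in `A ⊆ Y` represents a nontrivial element of the fundamental group of `Y`. -/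
def CarriesEssentialLoop {A Y : Set X} (h : A ⊆ Y) : Prop :=
  ∃ (x : A) (γ : Path x x),
    ¬ (γ.map (ContinuousMap.inclusion h).continuous).Homotopic
      (Path.refl (ContinuousMap.inclusion h x))

end Topology

end EinsteinGeometry

/-! Normalise a null vector orthogonal to `s` in an orthonormal frame of the complement of `s`, of
signature (2,2): it becomes a pair of unit vectors with angles α, β. So T₁ is the torus of pairs (α,
β) modulo the simultaneous shift by π, and exp(i(α+β)) descends to a nonvanishing function on it
(`windingFun`). If T₂ ≠ T₁, its vector `u` is not a multiple of `s`, so T₁ ∩ T₂ is cut out by a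
nonzero equation c cos(α-γ) + d cos(β-δ) = 0. Solving for the angle with the larger coefficient
gives a loop in the intersection along which the other angle winds once (`exists_angles`). There α+β
grows by 2π, and covering theory for exp excludes null-homotopies of this loop and of the inclusion.
-/

namespace EinsteinGeometry

/-! ### Orthonormal frames adapted to a spacelike vector -/

section Frames

variable {W : Type*} [AddCommGroup W] [Module ℝ W]

/-- A basis `e₁, e₂, f₁, f₂` of the orthogonal complement of `s` which is orthonormal of
signature `(2, 2)`, the last two vectors being negative. -/
structure SplitFrame (B : LinearMap.BilinForm ℝ W) (s : W) where
  (e₁ e₂ f₁ f₂ : W)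
  e₁_e₁ : B e₁ e₁ = 1
  e₂_e₂ : B e₂ e₂ = 1
  f₁_f₁ : B f₁ f₁ = -1
  f₂_f₂ : B f₂ f₂ = -1
  e₁_e₂ : B e₁ e₂ = 0
  e₁_f₁ : B e₁ f₁ = 0
  e₁_f₂ : B e₁ f₂ = 0
  e₂_f₁ : B e₂ f₁ = 0
  e₂_f₂ : B e₂ f₂ = 0
  f₁_f₂ : B f₁ f₂ = 0
  s_e₁ : B s e₁ = 0
  s_e₂ : B s e₂ = 0
  s_f₁ : B s f₁ = 0
  s_f₂ : B s f₂ = 0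
  expand : ∀ v, B s v = 0 → v = B v e₁ • e₁ + B v e₂ • e₂ - B v f₁ • f₁ - B v f₂ • f₂

theorem exists_orthogonal_basis_cons [FiniteDimensional ℝ W] {B : LinearMap.BilinForm ℝ W}
    (hB : B.IsSymm) {s : W} (hs : B s s ≠ 0) {n : ℕ} (hn : Module.finrank ℝ W = n + 1) :
    ∃ b : Module.Basis (Fin (n + 1)) ℝ W, B.IsOrthoᵢ b ∧ b 0 = s := by
  classical
  let N := B.orthogonal (ℝ ∙ s)
  have hc : IsCompl (ℝ ∙ s) N := LinearMap.BilinForm.isCompl_span_singleton_orthogonal hs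
  have hs0 : s ≠ 0 := fun h => hs (by simp [h])
  have hN : Module.finrank ℝ N = n := by
    have := Submodule.finrank_add_eq_of_isCompl hc
    rw [finrank_span_singleton hs0] at this
    omega
  have hmem : ∀ z, z ∈ N ↔ B s z = 0 := fun z =>
    ⟨fun h => h s (Submodule.mem_span_singleton_self s), fun h y hy => by
      obtain ⟨c, rfl⟩ := Submodule.mem_span_singleton.1 hy
      simp [h]⟩
  obtain ⟨v', hv'⟩ := LinearMap.BilinForm.exists_orthogonal_basis (B := B.restrict N)
    (LinearMap.BilinForm.isSymm_iff.1 (hB.restrict N))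
  let v : Module.Basis (Fin n) ℝ N := v'.reindex (finCongr hN)
  have hv : ∀ i j, i ≠ j → B (v i) (v j) = 0 := fun i j hij => by
    have := hv' (i := (finCongr hN).symm i) (j := (finCongr hN).symm j) (by simpa using hij)
    simpa [v] using this
  refine ⟨Module.Basis.mkFinCons s v (fun c x hx hcx => ?_)
    (fun z => ⟨-(B s z / B s s), ?_⟩), ?_, ?_⟩
  · have := congrArg (B s) hcx
    simpa [(hmem x).1 hx, hs] using this
  · rw [hmem]
    simp [hs]
  · intro i j hij
    rw [Module.Basis.coe_mkFinCons]
    have h0 : ∀ i, B s (v i) = 0 := fun i => (hmem _).1 (v i).2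
    change B (Fin.cons (α := fun _ => W) s (Subtype.val ∘ v) i)
      (Fin.cons (α := fun _ => W) s (Subtype.val ∘ v) j) = 0
    induction i using Fin.cases <;> induction j using Fin.cases
    · exact absurd rfl hij
    · simpa using h0 _
    · simpa using (hB.eq _ _).trans (h0 _)
    · simpa using hv _ _ fun h => hij (by rw [h])
  · simp [Module.Basis.coe_mkFinCons]

/-- By Sylvester's law an orthogonal basis starting with `s` has three positive and two negative
squares. As `s` uses up one positive square, rescaling the other four vectors gives the frame. -/
theorem exists_splitFrame {B : LinearMap.BilinForm ℝ W} (hB : HasSignature B 3 2) {s : W}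
    (hs : 0 < B s s) : Nonempty (SplitFrame B s) := by
  classical
  have : FiniteDimensional ℝ W := FiniteDimensional.of_finrank_pos (by rw [hB.finrank_eq]; norm_num)
  obtain ⟨b, hb, rfl⟩ := exists_orthogonal_basis_cons hB.symm hs.ne' (n := 4) hB.finrank_eq
  have hb' : (QuadraticMap.associated (R := ℝ) B.toQuadraticMap).IsOrthoᵢ b := by
    rwa [QuadraticMap.associated_left_inverse ℝ hB.symm.eq]
  have hequiv : QuadraticMap.Equivalent B.toQuadraticMap
      (QuadraticMap.weightedSumSquares ℝ fun i => B (b i) (b i)) :=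
    ⟨by
      have h := QuadraticMap.isometryEquivBasisRepr B.toQuadraticMap b
      rwa [QuadraticMap.basisRepr_eq_of_iIsOrtho _ b hb'] at h⟩
  have hp := QuadraticForm.sigPos_of_equiv_weightedSumSquares hequiv
  have hn := QuadraticForm.sigNeg_of_equiv_weightedSumSquares hequiv
  rw [hB.sigPos_eq] at hp
  rw [hB.sigNeg_eq] at hn
  have ho : ∀ i j, i ≠ j → B (b i) (b j) = 0 := fun i j hij => hb hij
  set w : Fin 5 → ℝ := fun i => B (b i) (b i) with hw
  have hpos : (Finset.univ.filter fun i => 0 < w i ∧ i ≠ 0).card = 2 := by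
    have h1 : (Finset.univ.filter fun i => 0 < w i).card = 3 := by
      rw [hp, ← Set.ncard_coe_finset]; congr 1; ext; simp [hw]
    have h2 : (Finset.univ.filter fun i => 0 < w i ∧ i ≠ 0) =
        (Finset.univ.filter fun i => 0 < w i).erase 0 := by
      ext; simp [and_comm]
    rw [h2, Finset.card_erase_of_mem (by simpa using hs), h1]
  have hneg : (Finset.univ.filter fun i => w i < 0).card = 2 := by
    rw [hn, ← Set.ncard_coe_finset]; congr 1; ext; simp [hw]
  obtain ⟨p, q, hpq, hP⟩ := Finset.card_eq_two.1 hpos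
  obtain ⟨m, n, hmn, hN⟩ := Finset.card_eq_two.1 hneg
  have hp' : 0 < w p ∧ p ≠ 0 := by simpa using (Finset.ext_iff.1 hP p).2 (by simp)
  have hq' : 0 < w q ∧ q ≠ 0 := by simpa using (Finset.ext_iff.1 hP q).2 (by simp)
  have hm' : w m < 0 := by simpa using (Finset.ext_iff.1 hN m).2 (by simp)
  have hn' : w n < 0 := by simpa using (Finset.ext_iff.1 hN n).2 (by simp)
  have h0 : 0 < w 0 := hs
  have hne : ∀ {i j}, w i < 0 → 0 < w j → i ≠ j := by
    rintro i j h h' rfl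
    exact lt_asymm h h'
  have huniv : ({0, p, q, m, n} : Finset (Fin 5)) = Finset.univ := by
    rw [← Finset.card_eq_iff_eq_univ, Fintype.card_fin]
    rw [Finset.card_insert_of_notMem, Finset.card_insert_of_notMem, Finset.card_insert_of_notMem,
      Finset.card_pair hmn]
    · simp [(hne hm' hq'.1).symm, (hne hn' hq'.1).symm]
    · simp [hpq, (hne hm' hp'.1).symm, (hne hn' hp'.1).symm]
    · simp [hp'.2.symm, hq'.2.symm, (hne hm' h0).symm, (hne hn' h0).symm]
  let c : Fin 5 → ℝ := fun i => (√|w i|)⁻¹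
  have hc : ∀ i, w i ≠ 0 → c i * c i * |w i| = 1 := fun i hi => by
    have h : √|w i| ≠ 0 := by positivity
    have h' : √|w i| * √|w i| = |w i| := Real.mul_self_sqrt (abs_nonneg _)
    calc c i * c i * |w i| = (√|w i| * √|w i|)⁻¹ * (√|w i| * √|w i|) := by
          rw [h', ← h', mul_inv]
      _ = 1 := inv_mul_cancel₀ (mul_ne_zero h h)
  have hcp : ∀ i, 0 < w i → c i * c i * w i = 1 := fun i hi => by
    rw [← hc i hi.ne', abs_of_pos hi]
  have hcn : ∀ i, w i < 0 → c i * c i * w i = -1 := fun i hi => by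
    have := hc i hi.ne
    rw [abs_of_neg hi] at this
    linarith
  have hself : ∀ i, B (c i • b i) (c i • b i) = c i * c i * w i := fun i => by
    simp [hw, mul_assoc]
  have hoff : ∀ i j, i ≠ j → B (c i • b i) (c j • b j) = 0 := fun i j hij => by
    simp [ho i j hij]
  have hrepr : ∀ v i, B v (b i) = b.repr v i * w i := fun v i => by
    conv_lhs => rw [← b.sum_repr v]
    rw [map_sum, LinearMap.sum_apply, Finset.sum_eq_single i]
    · simp [hw]
    · intro j _ hj
      simp [ho j i hj]
    · simp
  have hterm : ∀ v i, B v (c i • b i) • (c i • b i) = (c i * c i * w i) • b.repr v i • b i :=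
    fun v i => by
      rw [map_smul, hrepr, smul_smul, smul_smul]
      congr 1
      simp only [smul_eq_mul]
      ring
  refine ⟨⟨c p • b p, c q • b q, c m • b m, c n • b n, ?_, ?_, ?_, ?_, hoff _ _ hpq,
    hoff _ _ (hne hm' hp'.1).symm, hoff _ _ (hne hn' hp'.1).symm, hoff _ _ (hne hm' hq'.1).symm,
    hoff _ _ (hne hn' hq'.1).symm, hoff _ _ hmn, ?_, ?_, ?_, ?_, fun v hv => ?_⟩⟩
  · rw [hself, hcp p hp'.1]
  · rw [hself, hcp q hq'.1]
  · rw [hself, hcn m hm']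
  · rw [hself, hcn n hn']
  · simp [ho 0 p hp'.2.symm]
  · simp [ho 0 q hq'.2.symm]
  · simp [ho 0 m (hne hm' h0).symm]
  · simp [ho 0 n (hne hn' h0).symm]
  · have hv0 : b.repr v 0 = 0 := by
      have := hrepr v 0
      rw [hB.symm.eq, hv] at this
      exact (mul_eq_zero.1 this.symm).resolve_right h0.ne'
    rw [hterm, hterm, hterm, hterm, hcp p hp'.1, hcp q hq'.1, hcn m hm', hcn n hn']
    conv_lhs => rw [← b.sum_repr v, ← huniv]
    rw [Finset.sum_insert, Finset.sum_insert, Finset.sum_insert, Finset.sum_pair hmn, hv0]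
    · module
    · simp [(hne hm' hq'.1).symm, (hne hn' hq'.1).symm]
    · simp [hpq, (hne hm' hp'.1).symm, (hne hn' hp'.1).symm]
    · simp [hp'.2.symm, hq'.2.symm, (hne hm' h0).symm, (hne hn' h0).symm]

end Frames

end EinsteinGeometry

namespace EinsteinGeometry

/-! ### Winding obstructions from the exponential covering -/

section Lifting

open scoped unitInterval

variable {Y : Type*} [TopologicalSpace Y]

/-- A loop whose image under a nonvanishing function has a logarithm with different
end values is not null-homotopic. -/
theorem not_homotopic_refl_of_exp {f : C(Y, ℂ)} (hf : ∀ y, f y ≠ 0) {x : Y} (γ : Path x x)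
    (θ : C(I, ℂ)) (hθ : ∀ t, Complex.exp (θ t) = f (γ t)) (hne : θ 1 ≠ θ 0) :
    ¬ γ.Homotopic (Path.refl x) := by
  intro h
  let g : C(Y, {z : ℂ // z ≠ 0}) := ⟨fun y => ⟨f y, hf y⟩, by fun_prop⟩
  have cov := Complex.isCoveringMap_exp
  have h1 := h.map g
  have e0 : (γ.map g.continuous : C(I, {z : ℂ // z ≠ 0})) 0 =
      (⟨_, (θ 0).exp_ne_zero⟩ : {z : ℂ // z ≠ 0}) := by
    apply Subtype.ext
    simp [g, hθ]
  have e1 : ((Path.refl x).map g.continuous : C(I, {z : ℂ // z ≠ 0})) 0 =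
      (⟨_, (θ 0).exp_ne_zero⟩ : {z : ℂ // z ≠ 0}) := by
    apply Subtype.ext
    simp [g, hθ]
  -- Lifts of homotopic paths from a common start have the same end; here the two lifts are θ and a
  -- constant.
  have key := cov.liftPath_apply_one_eq_of_homotopicRel h1 (θ 0) e0 e1
  have k1 : θ = cov.liftPath _ (θ 0) e0 := by
    rw [cov.eq_liftPath_iff']
    refine ⟨funext fun t => Subtype.ext ?_, rfl⟩
    simp [g, hθ]
  have k2 : ContinuousMap.const I (θ 0) = cov.liftPath _ (θ 0) e1 := by
    rw [cov.eq_liftPath_iff']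
    refine ⟨funext fun t => Subtype.ext ?_, rfl⟩
    simp [g, hθ]
  exact hne ((DFunLike.congr_fun k1 1).trans (key.trans (DFunLike.congr_fun k2 1).symm))

/-- A map is not null-homotopic if it sends some loop to a loop whose image under a nonvanishing
function has a logarithm with different end values. -/
theorem not_nullhomotopic_of_exp {A : Type*} [TopologicalSpace A] {f : C(Y, ℂ)}
    (hf : ∀ y, f y ≠ 0) (i : C(A, Y)) {x : A} (γ : Path x x) (θ : C(I, ℂ))
    (hθ : ∀ t, Complex.exp (θ t) = f (i (γ t))) (hne : θ 1 ≠ θ 0) : ¬ i.Nullhomotopic := by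
  rintro ⟨y, ⟨H⟩⟩
  let g : C(Y, {z : ℂ // z ≠ 0}) := ⟨fun y => ⟨f y, hf y⟩, by fun_prop⟩
  have cov := Complex.isCoveringMap_exp
  -- The homotopy is reversed so that it starts at the constant map, which has a constant logarithm.
  -- Its lift ends in a continuous logarithm of `f ∘ i` on all of `A`, which must close up along γ.
  let K : C(I × A, {z : ℂ // z ≠ 0}) := g.comp H.symm.toContinuousMap
  have hK : ∀ a, K (0, a) = (⟨_, (Complex.log (f y)).exp_ne_zero⟩ : {z : ℂ // z ≠ 0}) := fun a => by
    apply Subtype.ext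
    simp [K, g, Complex.exp_log (hf y)]
  let L := cov.liftHomotopy K (ContinuousMap.const A (Complex.log (f y))) hK
  have hL : ∀ p, Complex.exp (L p) = K p := fun p =>
    congrArg Subtype.val (congrFun (cov.liftHomotopy_lifts K _ hK) p)
  let ψ : I → ℂ := fun t => L (1, γ t) + (θ 0 - L (1, γ 0))
  have h0 : Complex.exp (θ 0 - L (1, γ 0)) = 1 := by
    rw [Complex.exp_sub, hL, hθ]
    simp [K, g, hf]
  have hψ : θ = ψ := by
    refine cov.eq_of_comp_eq θ.continuous (by fun_prop) (funext fun t => Subtype.ext ?_) 0 ?_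
    · simp only [Function.comp_apply, ψ]
      rw [hθ, Complex.exp_add, h0, hL]
      simp [K, g]
    · simp [ψ]
  apply hne
  rw [hψ]
  simp [ψ]

end Lifting

/-! ### Loops of solutions on the torus of angles -/

section Angles

open Real

/-- On the torus of pairs of angles, the zero set of `c cos (α - γ) + d cos (β - δ)` contains a
loop along which `β` winds once and `α` does not wind, if `|d| ≤ |c|`. -/
theorem exists_angles_of_le {c d : ℝ} (γ δ : ℝ) (hc : 0 < c) (hd : 0 ≤ d) (hdc : d ≤ c) :
    ∃ α β : ℝ → ℝ, Continuous α ∧ Continuous β ∧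
      (∀ t, c * cos (α t - γ) + d * cos (β t - δ) = 0) ∧ α 1 = α 0 ∧ β 1 = β 0 + 2 * π := by
  -- Let β wind once and solve for α: d/c ≤ 1 keeps the argument of `arccos` in [-1, 1], and its
  -- periodicity in t makes α close up.
  refine ⟨fun t => γ + arccos (-(d / c * cos (2 * π * t))), fun t => δ + 2 * π * t,
    by fun_prop, by fun_prop, fun t => ?_, by simp, by simp⟩
  have h1 : |d / c * cos (2 * π * t)| ≤ 1 := by
    rw [abs_mul, abs_of_nonneg (by positivity)]
    exact mul_le_one₀ ((div_le_one hc).2 hdc) (abs_nonneg _) (abs_cos_le_one _)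
  rw [abs_le] at h1
  simp only [add_sub_cancel_left]
  rw [cos_arccos (by linarith) (by linarith)]
  field_simp
  ring

theorem exists_polar (x y : ℝ) :
    ∃ r γ : ℝ, 0 ≤ r ∧ (0 < r ↔ x ≠ 0 ∨ y ≠ 0) ∧ ∀ a, x * cos a + y * sin a = r * cos (a - γ) := by
  have h1 := Complex.norm_mul_cos_arg ⟨x, y⟩
  have h2 := Complex.norm_mul_sin_arg ⟨x, y⟩
  refine ⟨‖(⟨x, y⟩ : ℂ)‖, Complex.arg ⟨x, y⟩, norm_nonneg _, ?_, fun a => ?_⟩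
  · rw [norm_pos_iff, Ne, Complex.ext_iff]
    simp [imp_iff_not_or]
  · rw [cos_sub]
    simp only at h1 h2
    linear_combination -(cos a) * h1 - sin a * h2

/-- A nonzero linear equation in two points of the unit circle has a loop of solutions along
which exactly one of the two points winds once. -/
theorem exists_angles {c₁ c₂ d₁ d₂ : ℝ} (h : (c₁ ≠ 0 ∨ c₂ ≠ 0) ∨ (d₁ ≠ 0 ∨ d₂ ≠ 0)) :
    ∃ α β : ℝ → ℝ, Continuous α ∧ Continuous β ∧
      (∀ t, c₁ * cos (α t) + c₂ * sin (α t) + (d₁ * cos (β t) + d₂ * sin (β t)) = 0) ∧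
      (α 1 = α 0 ∧ β 1 = β 0 + 2 * π ∨ α 1 = α 0 + 2 * π ∧ β 1 = β 0) := by
  obtain ⟨c, γ, hc, hc', hcγ⟩ := exists_polar c₁ c₂
  obtain ⟨d, δ, hd, hd', hdδ⟩ := exists_polar d₁ d₂
  rw [← hc', ← hd'] at h
  simp only [hcγ, hdδ]
  rcases le_total d c with hdc | hcd
  · obtain ⟨α, β, hα, hβ, heq, h1, h2⟩ :=
      exists_angles_of_le γ δ (h.elim id fun h => h.trans_le hdc) hd hdc
    exact ⟨α, β, hα, hβ, heq, .inl ⟨h1, h2⟩⟩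
  · obtain ⟨β, α, hβ, hα, heq, h1, h2⟩ :=
      exists_angles_of_le δ γ (h.elim (fun h => h.trans_le hcd) id) hc hcd
    exact ⟨α, β, hα, hβ, fun t => (add_comm _ _).trans (heq t), .inr ⟨h2, h1⟩⟩

end Angles

end EinsteinGeometry

namespace EinsteinGeometry

/-! ### The winding function and the intersection of tori -/

section Tori

variable {W : Type*} [AddCommGroup W] [Module ℝ W] {B : LinearMap.BilinForm ℝ W} {s : W}

namespace SplitFrame

variable (F : SplitFrame B s)

/-- A positive definite quadratic form adapted to a split frame. -/
def posForm (v : W) : ℝ :=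
  B v s ^ 2 + (B v F.e₁ ^ 2 + B v F.e₂ ^ 2) + (B v F.f₁ ^ 2 + B v F.f₂ ^ 2)

theorem eq_zero_of_coords {v : W} (h : B s v = 0) (h₁ : B v F.e₁ = 0) (h₂ : B v F.e₂ = 0)
    (h₃ : B v F.f₁ = 0) (h₄ : B v F.f₂ = 0) : v = 0 := by
  rw [F.expand v h, h₁, h₂, h₃, h₄]
  simp

theorem posForm_pos (hB : B.IsSymm) {v : W} (hv : v ≠ 0) : 0 < F.posForm v := by
  have h0 : 0 ≤ F.posForm v := by unfold posForm; positivity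
  refine h0.lt_of_ne' fun h => hv ?_
  unfold posForm at h
  have h₀ := sq_nonneg (B v s)
  have h₁ := sq_nonneg (B v F.e₁)
  have h₂ := sq_nonneg (B v F.e₂)
  have h₃ := sq_nonneg (B v F.f₁)
  have h₄ := sq_nonneg (B v F.f₂)
  refine F.eq_zero_of_coords ((hB.eq _ _).trans ?_) ?_ ?_ ?_ ?_ <;>
    refine (pow_eq_zero_iff two_ne_zero).1 ?_ <;> linarith

/-- In terms of the complex coordinates `a`, `b` of a split frame, in which the form on the
orthogonal complement of `s` is `|a|² - |b|²`, the function `[v] ↦ 2 a b / q v` with `q` positive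
definite. -/
noncomputable def windingFun (p : ℙ ℝ W) : ℂ :=
  Projectivization.lift (K := ℝ)
    (fun v : {v : W // v ≠ 0} => -2 * ((B v.1 F.e₁ : ℂ) + B v.1 F.e₂ * Complex.I) *
      (B v.1 F.f₁ + B v.1 F.f₂ * Complex.I) / F.posForm v.1)
    (by
      rintro ⟨a, ha⟩ ⟨b, hb⟩ t (rfl : a = t • b)
      have ht : (t : ℂ) ≠ 0 := by
        rintro h
        exact ha (by rw [Complex.ofReal_eq_zero.1 h, zero_smul])
      have hq : F.posForm (t • b) = t ^ 2 * F.posForm b := by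
        simp only [posForm, map_smul, LinearMap.smul_apply, smul_eq_mul]
        ring
      simp only [hq, map_smul, LinearMap.smul_apply, smul_eq_mul]
      push_cast
      rw [← mul_div_mul_left _ (F.posForm b : ℂ) (pow_ne_zero 2 ht)]
      congr 1
      ring) p

theorem windingFun_mk {v : W} (hv : v ≠ 0) : F.windingFun (Projectivization.mk ℝ v hv) =
    -2 * ((B v F.e₁ : ℂ) + B v F.e₂ * Complex.I) * (B v F.f₁ + B v F.f₂ * Complex.I) /
      F.posForm v := rfl

theorem continuous_windingFun [TopologicalSpace W] [IsTopologicalAddGroup W] [ContinuousSMul ℝ W]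
    [T2Space W] [FiniteDimensional ℝ W] (hB : B.IsSymm) : Continuous F.windingFun := by
  have hc : ∀ e, Continuous fun v : {v : W // v ≠ 0} => B v.1 e := fun e =>
    (B.flip e).continuous_of_finiteDimensional.comp continuous_subtype_val
  refine Continuous.quotient_lift (s := projectivizationSetoid ℝ W) ?_ _
  have hC : ∀ e, Continuous fun v : {v : W // v ≠ 0} => (B v.1 e : ℂ) := fun e =>
    Complex.continuous_ofReal.comp (hc e)
  refine Continuous.div ?_ (Complex.continuous_ofReal.comp ?_) fun v => ?_
  · exact (continuous_const.mul ((hC _).add ((hC _).mul continuous_const))).mul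
      ((hC _).add ((hC _).mul continuous_const))
  · exact (((hc _).pow 2).add (((hc _).pow 2).add ((hc _).pow 2))).add
      (((hc _).pow 2).add ((hc _).pow 2))
  · exact Complex.ofReal_ne_zero.2 (F.posForm_pos hB v.2).ne'

theorem apply_self_of_perp {v : W} (h : B s v = 0) :
    B v v = B v F.e₁ ^ 2 + B v F.e₂ ^ 2 - (B v F.f₁ ^ 2 + B v F.f₂ ^ 2) := by
  have := congrArg (B v) (F.expand v h)
  simp only [map_sub, map_add, map_smul, smul_eq_mul] at this
  linear_combination this

/-- Nullity says |a| = |b|, so if either factor vanished, all coordinates and hence the vector would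
vanish. -/
theorem windingFun_ne_zero (hB : B.IsSymm) {p : ℙ ℝ W}
    (hp : p ∈ projectivize (nullCone B ∩ perp B s)) : F.windingFun p ≠ 0 := by
  obtain ⟨v, hv, ⟨hn, hs⟩, rfl⟩ := hp
  have hn' : B v v = 0 := hn
  have hs' : B s v = 0 := hs
  rw [F.apply_self_of_perp hs'] at hn'
  have hne : ¬ (B v F.e₁ = 0 ∧ B v F.e₂ = 0 ∧ B v F.f₁ = 0 ∧ B v F.f₂ = 0) :=
    fun ⟨h₁, h₂, h₃, h₄⟩ => hv (F.eq_zero_of_coords hs' h₁ h₂ h₃ h₄)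
  rw [F.windingFun_mk]
  refine div_ne_zero (mul_ne_zero (mul_ne_zero (by norm_num) ?_) ?_)
    (Complex.ofReal_ne_zero.2 (F.posForm_pos hB hv).ne')
  · intro h
    have h₁ : B v F.e₁ = 0 := by simpa using congrArg Complex.re h
    have h₂ : B v F.e₂ = 0 := by simpa using congrArg Complex.im h
    refine hne ⟨h₁, h₂, ?_, ?_⟩ <;> rw [h₁, h₂] at hn' <;> nlinarith
  · intro h
    have h₁ : B v F.f₁ = 0 := by simpa using congrArg Complex.re h
    have h₂ : B v F.f₂ = 0 := by simpa using congrArg Complex.im h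
    refine hne ⟨?_, ?_, h₁, h₂⟩ <;> rw [h₁, h₂] at hn' <;> nlinarith

/-- The null vector with polar angles `α` and `β` in a split frame. -/
noncomputable def nullVector (α β : ℝ) : W :=
  Real.cos α • F.e₁ + Real.sin α • F.e₂ + (Real.cos β • F.f₁ + Real.sin β • F.f₂)

theorem nullVector_e₁ (hB : B.IsSymm) (α β : ℝ) : B (F.nullVector α β) F.e₁ = Real.cos α := by
  simp [nullVector, F.e₁_e₁, hB.eq F.e₂, hB.eq F.f₁, hB.eq F.f₂, F.e₁_e₂, F.e₁_f₁, F.e₁_f₂]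

theorem nullVector_e₂ (hB : B.IsSymm) (α β : ℝ) : B (F.nullVector α β) F.e₂ = Real.sin α := by
  simp [nullVector, F.e₂_e₂, hB.eq F.f₁, hB.eq F.f₂, F.e₁_e₂, F.e₂_f₁, F.e₂_f₂]

theorem nullVector_f₁ (hB : B.IsSymm) (α β : ℝ) : B (F.nullVector α β) F.f₁ = -Real.cos β := by
  simp [nullVector, F.f₁_f₁, hB.eq F.f₂, F.e₁_f₁, F.e₂_f₁, F.f₁_f₂]

theorem nullVector_f₂ (α β : ℝ) : B (F.nullVector α β) F.f₂ = -Real.sin β := by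
  simp [nullVector, F.f₂_f₂, F.e₁_f₂, F.e₂_f₂, F.f₁_f₂]

theorem apply_nullVector (u : W) (α β : ℝ) : B u (F.nullVector α β) =
    B u F.e₁ * Real.cos α + B u F.e₂ * Real.sin α +
      (B u F.f₁ * Real.cos β + B u F.f₂ * Real.sin β) := by
  simp [nullVector, mul_comm]

theorem perp_nullVector (α β : ℝ) : B s (F.nullVector α β) = 0 := by
  rw [apply_nullVector, F.s_e₁, F.s_e₂, F.s_f₁, F.s_f₂]
  ring

theorem nullVector_null (hB : B.IsSymm) (α β : ℝ) :
    B (F.nullVector α β) (F.nullVector α β) = 0 := by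
  rw [F.apply_nullVector, F.nullVector_e₁ hB, F.nullVector_e₂ hB, F.nullVector_f₁ hB,
    F.nullVector_f₂]
  linear_combination Real.cos_sq_add_sin_sq α - Real.cos_sq_add_sin_sq β

theorem nullVector_ne_zero (hB : B.IsSymm) (α β : ℝ) : F.nullVector α β ≠ 0 := by
  intro h
  have h₁ := F.nullVector_e₁ hB α β
  have h₂ := F.nullVector_e₂ hB α β
  have h₃ := Real.cos_sq_add_sin_sq α
  rw [h, map_zero, LinearMap.zero_apply] at h₁ h₂
  rw [← h₁, ← h₂] at h₃
  norm_num at h₃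

/-- The factor -2 in `windingFun` is explained here: pairing with the negative vectors gives
-exp(iβ), and `posForm` equals 2. -/
theorem windingFun_nullVector (hB : B.IsSymm) (α β : ℝ) :
    F.windingFun (Projectivization.mk ℝ _ (F.nullVector_ne_zero hB α β)) =
      Complex.exp ((α + β : ℝ) * Complex.I) := by
  have hq : F.posForm (F.nullVector α β) = 2 := by
    rw [posForm, hB.eq, F.perp_nullVector, F.nullVector_e₁ hB, F.nullVector_e₂ hB,
      F.nullVector_f₁ hB, F.nullVector_f₂]
    linear_combination Real.cos_sq_add_sin_sq α + Real.cos_sq_add_sin_sq β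
  rw [F.windingFun_mk, hq, F.nullVector_e₁ hB, F.nullVector_e₂ hB, F.nullVector_f₁ hB,
    F.nullVector_f₂]
  push_cast
  rw [add_mul, Complex.exp_add, Complex.exp_mul_I, Complex.exp_mul_I]
  ring

end SplitFrame

-- `A` need only contain the intersection, so that either order of the two tori can be used.
open scoped unitInterval in
theorem not_contractibleIn_and_carriesEssentialLoop [TopologicalSpace W] [IsTopologicalAddGroup W]
    [ContinuousSMul ℝ W] [T2Space W] [FiniteDimensional ℝ W] (hB : B.IsSymm) (F : SplitFrame B s)
    {u : W} (hu : (B u F.e₁ ≠ 0 ∨ B u F.e₂ ≠ 0) ∨ (B u F.f₁ ≠ 0 ∨ B u F.f₂ ≠ 0))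
    {A Y : Set (ℙ ℝ W)} (hY : Y = projectivize (nullCone B ∩ perp B s)) (hAY : A ⊆ Y)
    (hA : Y ∩ projectivize (nullCone B ∩ perp B u) ⊆ A) :
    ¬ ContractibleIn hAY ∧ CarriesEssentialLoop hAY := by
  obtain ⟨α, β, hα, hβ, heq, h01⟩ := exists_angles hu
  let v : I → {v : W // v ≠ 0} := fun t =>
    ⟨F.nullVector (α t) (β t), F.nullVector_ne_zero hB _ _⟩
  have hv : Continuous v := by
    refine Continuous.subtype_mk ?_ _
    unfold SplitFrame.nullVector
    fun_prop
  have hmk : Continuous (Projectivization.mk' ℝ : {v : W // v ≠ 0} → ℙ ℝ W) :=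
    continuous_quotient_mk' (s := projectivizationSetoid ℝ W)
  have hmem : ∀ t, Projectivization.mk' ℝ (v t) ∈ A := fun t => hA
    ⟨hY ▸ ⟨_, (v t).2, ⟨F.nullVector_null hB _ _, F.perp_nullVector _ _⟩, rfl⟩,
      ⟨_, (v t).2, ⟨F.nullVector_null hB _ _, (F.apply_nullVector _ _ _).trans (heq t)⟩, rfl⟩⟩
  have hv01 : v 1 = v 0 := by
    apply Subtype.ext
    rcases h01 with ⟨h1, h2⟩ | ⟨h1, h2⟩ <;> simp [v, SplitFrame.nullVector, h1, h2]
  let γ : Path (⟨_, hmem 0⟩ : A) ⟨_, hmem 0⟩ :=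
    { toFun := fun t => ⟨_, hmem t⟩
      continuous_toFun := (hmk.comp hv).subtype_mk _
      source' := rfl
      target' := by simp only [hv01] }
  let f : C(Y, ℂ) := ⟨fun y => F.windingFun y,
    (F.continuous_windingFun hB).comp continuous_subtype_val⟩
  have hf : ∀ y, f y ≠ 0 := fun y => F.windingFun_ne_zero hB (hY ▸ y.2)
  let θ : C(I, ℂ) := ⟨fun t => (α t + β t : ℝ) * Complex.I, by fun_prop⟩
  have hθ : ∀ t, Complex.exp (θ t) = f (ContinuousMap.inclusion hAY (γ t)) := fun t =>
    (F.windingFun_nullVector hB (α t) (β t)).symm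
  have hne : θ 1 ≠ θ 0 := by
    have h : α 1 + β 1 ≠ α 0 + β 0 := by
      have := Real.pi_pos
      rcases h01 with ⟨h1, h2⟩ | ⟨h1, h2⟩ <;> rw [h1, h2] <;> intro h <;> linarith
    intro h'
    have := mul_right_cancel₀ Complex.I_ne_zero h'
    exact h (by exact_mod_cast this)
  exact ⟨not_nullhomotopic_of_exp hf _ γ θ hθ hne, _, γ,
    not_homotopic_refl_of_exp hf _ θ hθ hne⟩

/-- The intersection of two distinct Einstein tori is essential in the first one. -/
theorem inter_essential [TopologicalSpace W] [IsTopologicalAddGroup W]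
    [ContinuousSMul ℝ W] [T2Space W] (hB : HasSignature B 3 2) {T₁ T₂ A : Set (ℙ ℝ W)}
    (hT₁ : IsEinsteinHyperplane B T₁) (hT₂ : IsEinsteinHyperplane B T₂) (hne : T₁ ≠ T₂)
    (hA : A ⊆ T₁) (hA' : T₁ ∩ T₂ ⊆ A) : ¬ ContractibleIn hA ∧ CarriesEssentialLoop hA := by
  have : FiniteDimensional ℝ W := FiniteDimensional.of_finrank_pos (by rw [hB.finrank_eq]; norm_num)
  obtain ⟨s, hs, rfl⟩ := hT₁
  obtain ⟨u, hu, rfl⟩ := hT₂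
  obtain ⟨F⟩ := exists_splitFrame hB hs
  refine not_contractibleIn_and_carriesEssentialLoop hB.symm F (u := u) ?_ rfl hA hA'
  by_contra! h
  obtain ⟨⟨h₁, h₂⟩, h₃, h₄⟩ := h
  -- If all coefficients vanish, the projection of `u` to the complement of `s` is zero, so `u` is a
  -- multiple of `s` and the tori coincide.
  have hus : u - (B s u / B s s) • s = 0 := by
    refine F.eq_zero_of_coords ?_ ?_ ?_ ?_ ?_ <;>
      simp [h₁, h₂, h₃, h₄, F.s_e₁, F.s_e₂, F.s_f₁, F.s_f₂, hs.ne']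
  obtain ⟨c, rfl⟩ : ∃ c : ℝ, u = c • s := ⟨_, sub_eq_zero.1 hus⟩
  have hc : c ≠ 0 := by
    rintro rfl
    simp at hu
  apply hne
  have : perp B s = perp B (c • s) := by
    ext v
    simp [perp, hc]
  rw [this]

end Tori

end EinsteinGeometry

theorem mainTheorem5 {W : Type*} [AddCommGroup W] [Module ℝ W] [TopologicalSpace W]
    [IsTopologicalAddGroup W] [ContinuousSMul ℝ W] [T2Space W]
    (B : LinearMap.BilinForm ℝ W) (hB : EinsteinGeometry.HasSignature B 3 2)
    (T₁ T₂ : Set (ℙ ℝ W))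
    (hT₁ : EinsteinGeometry.IsEinsteinHyperplane B T₁)
    (hT₂ : EinsteinGeometry.IsEinsteinHyperplane B T₂)
    (hne : T₁ ≠ T₂) :
    (¬ EinsteinGeometry.ContractibleIn (Set.inter_subset_left : T₁ ∩ T₂ ⊆ T₁) ∧
      ¬ EinsteinGeometry.ContractibleIn (Set.inter_subset_right : T₁ ∩ T₂ ⊆ T₂)) ∧
    (EinsteinGeometry.CarriesEssentialLoop (Set.inter_subset_left : T₁ ∩ T₂ ⊆ T₁) ∧
      EinsteinGeometry.CarriesEssentialLoop (Set.inter_subset_right : T₁ ∩ T₂ ⊆ T₂)) := by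
  have h₁ := EinsteinGeometry.inter_essential hB hT₁ hT₂ hne Set.inter_subset_left subset_rfl
  have h₂ := EinsteinGeometry.inter_essential hB hT₂ hT₁ hne.symm
    (Set.inter_subset_right : T₁ ∩ T₂ ⊆ T₂) (Set.inter_comm T₂ T₁).subset
  exact ⟨⟨h₁.1, h₂.1⟩, h₁.2, h₂.2⟩
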